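/- Let $\tilde V$ (main channel, output $Y$) and $\tilde W$ (wiretapper's channel, output $Z$) be binary-input memoryless symmetric channels with arbitrary (discrete or continuous) output alphabets, i.e. for each of them a measurable involution of the output alphabet exchanges the output laws given input $0$ and given input $1$; assume that $\tilde W$ is stochastically degraded with respect to $\tilde V$. For $N=2^m$, $m\ge 1$, let $G_N=\left[\begin{smallmatrix}1&0\\1&1\end{smallmatrix}\right]^{\otimes m}$ over $\mathbb F_2$ (so $G_N^{-1}=G_N$). For a binary-input channel $Q$ let $Q_N(\cdot\mid u^{[N]})$ be the law of the output of $N$ independent uses of $Q$ with input $x^{[N]}=u^{[N]}G_N$, and for $i\in[N]$ let $Q_N^{(i)}$ be the $i$-th subchannel $$Q_N^{(i)}(y^{[N]},u^{1:i-1}\mid u^i)=\sum_{u^{i+1:N}}2^{-(N-1)}\,Q_N(y^{[N]}\mid u^{[N]}).$$ Let $\tilde Z(Q)=\sum_y\sqrt{Q(y|0)Q(y|1)}$ be the Bhattacharyya parameter (an integral of densities with respect to a dominating measure if the output is not discrete). For $0<\beta<\tfrac12$ put $$\mathcal G=\{i:\tilde Z(\tilde V_N^{(i)})\le 2^{-N^\beta}\},\qquad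 \mathcal N=\{i:\tilde Z(\tilde W_N^{(i)})\ge 1-2^{-N^\beta}\},$$ $\mathcal A=\mathcal G\cap\mathcal N$, $\mathcal B=\mathcal G\cap\mathcal N^c$, $\mathcal C=\mathcal G^c\cap\mathcal N$, $\mathcal D=\mathcal G^c\cap\mathcal N^c$. Let $U^{[N]}$ be formed by putting message bits $M$ on $\mathcal A$, frozen bits $F$ on $\mathcal C$, and random bits $R$ on $\mathcal B\cup\mathcal D$, where $R$ is uniformly distributed and independent of $(M,F)$ and the joint law of $(M,F)$ is arbitrary (in particular $F$ may be a fixed string), and let $Z^{[N]}$ be the wiretapper's output, with conditional law $\tilde W_N(\cdot\mid u^{[N]})$ given $U^{[N]}=u^{[N]}$. Then for all $0<\beta'<\beta<\tfrac12$ there is an $N_0$, depending only on $\beta$ and $\beta'$, such that for all $N=2^m\ge N_0$, all such channels and all such $(M,F,R)$, the information leakage, measured in bits, satisfies $$I(M;Z^{[N]})\le N\cdot 2^{-N^{\beta'}}.$$ -/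

import Mathlib

open MeasureTheory ProbabilityTheory
open scoped ENNReal

noncomputable section

namespace PolarWiretap

/-! ### Binary-input channels

A binary-input memoryless channel with an arbitrary (discrete or continuous) measurable output
alphabet is a Markov kernel from `ZMod 2`. -/

/-- A binary-input memoryless symmetric (BMS) channel: a Markov kernel for which a measurable
involution of the output alphabet exchanges the two conditional output laws. -/
structure IsBMS {𝓨 : Type*} [MeasurableSpace 𝓨] (W : Kernel (ZMod 2) 𝓨) : Prop where
  markov : IsMarkovKernel W
  symm : ∃ π : 𝓨 → 𝓨, Measurable π ∧ Function.Involutive π ∧ W 1 = (W 0).map π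

/-- `W` is (stochastically) degraded with respect to `V`. -/
def IsDegraded {𝓨 𝓩 : Type*} [MeasurableSpace 𝓨] [MeasurableSpace 𝓩]
    (W : Kernel (ZMod 2) 𝓩) (V : Kernel (ZMod 2) 𝓨) : Prop :=
  ∃ κ : Kernel 𝓨 𝓩, IsMarkovKernel κ ∧ W = κ ∘ₖ V

/-- The Bhattacharyya parameter `∫ √(p(y|0) p(y|1)) dμ(y)`, with the densities taken with respect
to the dominating measure `μ = W(·|0) + W(·|1)` (the integral does not depend on the dominating
measure; for a discrete alphabet it is `∑ y, √(W(y|0) W(y|1))`). -/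
def bhattacharyya {𝓨 : Type*} [MeasurableSpace 𝓨] (W : Kernel (ZMod 2) 𝓨) : ℝ :=
  ∫ y, √(((W 0).rnDeriv (W 0 + W 1) y).toReal * ((W 1).rnDeriv (W 0 + W 1) y).toReal)
    ∂(W 0 + W 1)

/-! ### The polarization transform -/

/-- The generator matrix `G_N = [1 0; 1 1]^{⊗ m}` over `𝔽₂`, of size `N = 2 ^ m`. -/
def polarMatrix : (m : ℕ) → Matrix (Fin (2 ^ m)) (Fin (2 ^ m)) (ZMod 2)
  | 0 => 1
  | m + 1 =>
    Matrix.reindex (finProdFinEquiv.trans (finCongr (pow_succ 2 m).symm))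
      (finProdFinEquiv.trans (finCongr (pow_succ 2 m).symm))
      (Matrix.kronecker (polarMatrix m) !![1, 0; 1, 1])

/-- `G_N` is an involution over `𝔽₂`, so that `u = x G_N` and `x = u G_N` are equivalent. -/
theorem polarMatrix_mul_self (m : ℕ) : polarMatrix m * polarMatrix m = 1 := by
  induction m with
  | zero => simp [polarMatrix]
  | succ m ih =>
    have h : (!![1, 0; 1, 1] * !![1, 0; 1, 1] : Matrix (Fin 2) (Fin 2) (ZMod 2)) = 1 := by
      decide
    simp only [polarMatrix, Matrix.reindex_apply, Matrix.submatrix_mul_equiv]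
    rw [Matrix.kronecker, ← Matrix.mul_kronecker_mul, ih, h, Matrix.one_kronecker_one,
      Matrix.submatrix_one_equiv]

/-- The combined channel `W_N` from `u^{[N]}` to `y^{[N]}`, for `N = 2 ^ m`: the word
`x = u G_N` is sent through `N` independent uses of `W`. -/
def combinedChannel {𝓨 : Type*} [MeasurableSpace 𝓨] (W : Kernel (ZMod 2) 𝓨) (m : ℕ) :
    Kernel (Fin (2 ^ m) → ZMod 2) (Fin (2 ^ m) → 𝓨) :=
  Kernel.ofFunOfCountable fun u =>
    Measure.pi fun i => W (Matrix.vecMul u (polarMatrix m) i)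

instance {𝓨 : Type*} [MeasurableSpace 𝓨] (W : Kernel (ZMod 2) 𝓨) [IsMarkovKernel W] (m : ℕ) :
    IsMarkovKernel (combinedChannel W m) :=
  ⟨fun u => inferInstanceAs (IsProbabilityMeasure
    (Measure.pi fun i => W (Matrix.vecMul u (polarMatrix m) i)))⟩

/-- The `i`-th subchannel `W_N^{(i)}`, from `u^i` to `(y^{[N]}, u^{1:i-1})`, whose transition
probabilities are `∑_{u^{i+1:N}} 2^{-(N-1)} W_N(y^{[N]} | u^{[N]})`. -/
def subchannel {𝓨 : Type*} [MeasurableSpace 𝓨] (W : Kernel (ZMod 2) 𝓨) (m : ℕ)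
    (i : Fin (2 ^ m)) :
    Kernel (ZMod 2) ((Fin (2 ^ m) → 𝓨) × ({j : Fin (2 ^ m) // j < i} → ZMod 2)) :=
  Kernel.ofFunOfCountable fun b =>
    ∑ u : Fin (2 ^ m) → ZMod 2 with u i = b,
      ((2 : ℝ≥0∞) ^ (2 ^ m - 1))⁻¹ •
        (combinedChannel W m u).prod (Measure.dirac fun j : {j : Fin (2 ^ m) // j < i} => u j)

/-! ### The partition of the index set -/

/-- The reliability-good indices `𝒢(V) = {i : Z(V_N^{(i)}) ≤ 2^{-N^β}}`, `N = 2 ^ m`. -/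
def goodSet {𝓨 : Type*} [MeasurableSpace 𝓨] (V : Kernel (ZMod 2) 𝓨) (β : ℝ) (m : ℕ) :
    Set (Fin (2 ^ m)) :=
  {i | bhattacharyya (subchannel V m i) ≤ (2 : ℝ) ^ (-(((2 : ℝ) ^ m) ^ β))}

/-- The information-poor indices `𝒩(W) = {i : Z(W_N^{(i)}) ≥ 1 - 2^{-N^β}}`, `N = 2 ^ m`. -/
def poorSet {𝓩 : Type*} [MeasurableSpace 𝓩] (W : Kernel (ZMod 2) 𝓩) (β : ℝ) (m : ℕ) :
    Set (Fin (2 ^ m)) :=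
  {i | 1 - (2 : ℝ) ^ (-(((2 : ℝ) ^ m) ^ β)) ≤ bhattacharyya (subchannel W m i)}

section Partition

variable {𝓨 𝓩 : Type*} [MeasurableSpace 𝓨] [MeasurableSpace 𝓩]
  (V : Kernel (ZMod 2) 𝓨) (W : Kernel (ZMod 2) 𝓩) (β : ℝ) (m : ℕ)

/-- `𝒜 = 𝒢(V) ∩ 𝒩(W)`. -/
def setA : Set (Fin (2 ^ m)) := goodSet V β m ∩ poorSet W β m

/-- `ℬ = 𝒢(V) ∩ 𝒩(W)ᶜ`. -/
def setB : Set (Fin (2 ^ m)) := goodSet V β m ∩ (poorSet W β m)ᶜ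

/-- `𝒞 = 𝒢(V)ᶜ ∩ 𝒩(W)`. -/
def setC : Set (Fin (2 ^ m)) := (goodSet V β m)ᶜ ∩ poorSet W β m

/-- `𝒟 = 𝒢(V)ᶜ ∩ 𝒩(W)ᶜ`. -/
def setD : Set (Fin (2 ^ m)) := (goodSet V β m)ᶜ ∩ (poorSet W β m)ᶜ

end Partition

/-! ### The coding scheme and the leakage -/

/-- The mutual information `I(X; Y)`, in bits: the Kullback-Leibler divergence of the joint law
from the product of the marginal laws. -/
def mutualInfo {Ω α β : Type*} [MeasurableSpace Ω] [MeasurableSpace α] [MeasurableSpace β]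
    (P : Measure Ω) (X : Ω → α) (Y : Ω → β) : ℝ≥0∞ :=
  InformationTheory.klDiv (P.map fun ω => (X ω, Y ω)) ((P.map X).prod (P.map Y)) /
    ENNReal.ofReal (Real.log 2)

/-- The assignment `𝒜 ← M`, `ℬ ← R`, `𝒞 ← F`, `𝒟 ← R'`, with wiretapper's output `Z`.
The random bits `(R, R')` are uniform and independent of `(M, F)`; the joint law of the message
bits `M` and the frozen bits `F` is arbitrary (in particular `F` may be deterministic). The
assembled word `U` is sent through the combined channel of `N = 2 ^ m` uses of `W`. -/
structure IsWiretapScheme {Ω 𝓩 : Type*} [MeasurableSpace Ω] [MeasurableSpace 𝓩]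
    (P : Measure Ω) (W : Kernel (ZMod 2) 𝓩) {m : ℕ} (A B C D : Set (Fin (2 ^ m)))
    (M : Ω → A → ZMod 2) (R : Ω → B → ZMod 2) (F : Ω → C → ZMod 2) (R' : Ω → D → ZMod 2)
    (U : Ω → Fin (2 ^ m) → ZMod 2) (Z : Ω → Fin (2 ^ m) → 𝓩) : Prop where
  measurable_M : Measurable M
  measurable_R : Measurable R
  measurable_F : Measurable F
  measurable_R' : Measurable R'
  measurable_Z : Measurable Z
  random_uniform : HasLaw (fun ω => (R ω, R' ω)) (uniformOn Set.univ) P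
  random_indep : IndepFun (fun ω => (M ω, F ω)) (fun ω => (R ω, R' ω)) P
  assign_A : ∀ ω (i : A), U ω i = M ω i
  assign_B : ∀ ω (i : B), U ω i = R ω i
  assign_C : ∀ ω (i : C), U ω i = F ω i
  assign_D : ∀ ω (i : D), U ω i = R' ω i
  channel : HasCondDistrib Z U (combinedChannel W m) P

end PolarWiretap

end

/-!
Two words agree on a set `S` of positions exactly when they are congruent modulo the subgroup of
words vanishing on `S`. Let `S` contain the positions of `M` and `F`. The law of `U` is then
invariant under this subgroup and `M` is constant on its cosets, so the joint law of `M` and `Z`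
does not change when the channel is preceded by the addition of a uniform element of the subgroup.

For every law of `U`, the leakage is thus at most the divergence of this randomized channel from the
completely randomized one, whose output does not depend on the word: replacing the law of `Z` by
any other law does not decrease the divergence, and applying `U ↦ M` does not increase it. By the
symmetry of the channel this divergence is the same at every word, so that it may be computed for a
uniform `U`. Adding the positions of `S` in increasing order, one after the other, each `i` costs at
most `2 * (1 - Z_i)`, where `Z_i` is the Bhattacharyya parameter of the `i`-th subchannel.
-/

noncomputable section

open scoped BigOperators

namespace PolarWiretap

section CosetMean

variable {G : Type*} [AddCommGroup G] [Fintype G] {H K : AddSubgroup G} {g : G → ℝ}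

open Classical in
/-- The mean of `g` over the coset `u + H`: the conditional expectation of `g` given the class of
`u` modulo `H`, when `u` is uniform on `G`. -/
def cosetMean (H : AddSubgroup G) (g : G → ℝ) (u : G) : ℝ := 𝔼 h : H, g (u + h)

lemma cosetMean_nonneg (hg : ∀ u, 0 ≤ g u) (u : G) : 0 ≤ cosetMean H g u :=
  Finset.expect_nonneg fun _ _ => hg _

open Classical in
lemma cosetMean_top (u : G) : cosetMean ⊤ g u = 𝔼 v, g v :=
  Fintype.expect_equiv (AddSubgroup.topEquiv.toEquiv.trans (Equiv.addLeft u)) _ _ fun _ => rfl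

open Classical in
lemma cosetMean_add_of_mem {h : G} (hh : h ∈ H) (u : G) :
    cosetMean H g (u + h) = cosetMean H g u :=
  Fintype.expect_equiv (Equiv.addLeft (⟨h, hh⟩ : H)) _ _ fun k => by simp [add_assoc]

lemma cosetMean_comp_add_right (a u : G) :
    cosetMean H (fun v => g (v + a)) u = cosetMean H g (u + a) := by
  simp only [cosetMean, add_right_comm]

lemma cosetMean_cosetMean_of_le (hKH : K ≤ H) (u : G) :
    cosetMean H (cosetMean K g) u = cosetMean H g u := by
  classical
  calc cosetMean H (cosetMean K g) u
      = 𝔼 k : K, 𝔼 h : H, g (u + k + h) := by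
        simp only [cosetMean]
        rw [Finset.expect_comm]
        simp only [add_right_comm]
    _ = 𝔼 _k : K, cosetMean H g u :=
        Finset.expect_congr rfl fun k _ => cosetMean_add_of_mem (hKH k.2) u
    _ = cosetMean H g u := Fintype.expect_const _

lemma expect_cosetMean : 𝔼 u, cosetMean H g u = 𝔼 u, g u := by
  rw [← cosetMean_top 0, cosetMean_cosetMean_of_le le_top, cosetMean_top]

lemma cosetMean_eq_zero_of_expect_eq_zero (hg : ∀ u, 0 ≤ g u) (h : 𝔼 u, g u = 0) (u : G) :
    cosetMean H g u = 0 :=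
  (Finset.expect_eq_zero_iff_of_nonneg fun v _ => cosetMean_nonneg hg v).1
    (expect_cosetMean.trans h) u (Finset.mem_univ u)

lemma cosetMean_sqrt_mul_le {f : G → ℝ} (hg : ∀ u, 0 ≤ g u) (hf : ∀ u, 0 ≤ f u) (u : G) :
    cosetMean H (fun v => √(g v * f v)) u ≤ √(cosetMean H g u * cosetMean H f u) := by
  simp only [cosetMean, Fintype.expect_eq_sum_div_card]
  rw [div_mul_div_comm, Real.sqrt_div' _ (by positivity), Real.sqrt_mul_self (by positivity),
    Real.sqrt_mul (Finset.sum_nonneg fun _ _ => hg _)]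
  gcongr
  simpa only [Real.sqrt_mul (hg _)] using
    Real.sum_sqrt_mul_sqrt_le _ (fun h : H => hg (u + h)) fun h => hf (u + h)

lemma cosetMean_eq_half_add (hKH : K ≤ H) {e : G} (he : e ∈ H) (hee : e + e ∈ K)
    (hcover : ∀ h ∈ H, h ∈ K ∨ h + e ∈ K) (u : G) :
    cosetMean H g u = (cosetMean K g u + cosetMean K g (u + e)) / 2 := by
  classical
  have hneg : cosetMean K g (u - e) = cosetMean K g (u + e) := by
    rw [← cosetMean_add_of_mem (u := u - e) hee, sub_add_add_cancel]
  have hpair (h : H) : cosetMean K g (u + h) + cosetMean K g (u + e + h) =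
      cosetMean K g u + cosetMean K g (u + e) := by
    rcases hcover h h.2 with hK | hK
    · rw [cosetMean_add_of_mem hK, cosetMean_add_of_mem hK]
    · have hsub : cosetMean K g (u + h) = cosetMean K g (u - e) := by
        rw [← cosetMean_add_of_mem (u := u - e) hK, sub_add_add_cancel]
      rw [hsub, hneg, add_assoc u, add_comm e, cosetMean_add_of_mem hK, add_comm]
  calc cosetMean H g u
      = (cosetMean H (cosetMean K g) u + cosetMean H (cosetMean K g) (u + e)) / 2 := by
        rw [cosetMean_add_of_mem he, add_self_div_two, cosetMean_cosetMean_of_le hKH]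
    _ = (𝔼 h : H, (cosetMean K g (u + h) + cosetMean K g (u + e + h))) / 2 := by
        rw [Finset.expect_add_distrib]; rfl
    _ = (cosetMean K g u + cosetMean K g (u + e)) / 2 := by
        rw [Finset.expect_congr rfl fun h _ => hpair h, Fintype.expect_const]

end CosetMean

section Entropy

lemma mul_log_sub_mul_log_le {x s : ℝ} (hx : 0 ≤ x) (hs : 0 < s) :
    x * Real.log x - x * Real.log s ≤ x * (x / s - 1) := by
  rcases hx.eq_or_lt with rfl | hx
  · simp
  · rw [← mul_sub, ← Real.log_div hx.ne' hs.ne']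
    gcongr
    exact Real.log_le_sub_one_of_pos (div_pos hx hs)

lemma sqrt_mul_le_half_add {a b : ℝ} (ha : 0 ≤ a) (hb : 0 ≤ b) : √(a * b) ≤ (a + b) / 2 :=
  Real.sqrt_le_iff.2 ⟨by positivity, by nlinarith [sq_nonneg (a - b)]⟩

lemma half_mul_log_add_mul_log_sub_le {a b : ℝ} (ha : 0 ≤ a) (hb : 0 ≤ b) :
    (a * Real.log a + b * Real.log b) / 2 - (a + b) / 2 * Real.log ((a + b) / 2) ≤
      a + b - 2 * √(a * b) := by
  rcases (add_nonneg ha hb).eq_or_lt with h | h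
  · obtain ⟨rfl, rfl⟩ := (add_eq_zero_iff_of_nonneg ha hb).1 h.symm
    simp
  have hsq : a * (a / ((a + b) / 2) - 1) + b * (b / ((a + b) / 2) - 1) =
      (a - b) ^ 2 / (a + b) := by
    field_simp
    ring
  have hsqrt : (a - b) ^ 2 / (a + b) ≤ 2 * (a + b - 2 * √(a * b)) := by
    rw [div_le_iff₀ h, Real.sqrt_mul ha]
    nlinarith [Real.sq_sqrt ha, Real.sq_sqrt hb, sq_nonneg ((√a - √b) ^ 2)]
  linarith [mul_log_sub_mul_log_le ha (half_pos h), mul_log_sub_mul_log_le hb (half_pos h)]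

section Step

variable {G : Type*} [AddCommGroup G] [Fintype G] {H K : AddSubgroup G} {g : G → ℝ}

lemma expect_mul_log_cosetMean_le (hKH : K ≤ H) {e : G} (he : e ∈ H) (hee : e + e ∈ K)
    (hcover : ∀ h ∈ H, h ∈ K ∨ h + e ∈ K) (hg : ∀ u, 0 ≤ g u) :
    𝔼 u, cosetMean K g u * Real.log (cosetMean K g u) ≤
      𝔼 u, cosetMean H g u * Real.log (cosetMean H g u) +
        2 * (𝔼 u, g u - 𝔼 u, √(cosetMean K g u * cosetMean K g (u + e))) := by
  have hshift (f : G → ℝ) : 𝔼 u, f (u + e) = 𝔼 u, f u :=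
    Fintype.expect_equiv (Equiv.addRight e) _ _ fun _ => rfl
  have hmean := Finset.expect_le_expect (s := Finset.univ) fun u _ =>
    half_mul_log_add_mul_log_sub_le (cosetMean_nonneg (H := K) hg u)
      (cosetMean_nonneg (H := K) hg (u + e))
  simp only [← cosetMean_eq_half_add hKH he hee hcover, Finset.expect_sub_distrib,
    ← Finset.expect_div, Finset.expect_add_distrib, ← Finset.mul_expect,
    hshift fun u => cosetMean K g u * Real.log (cosetMean K g u),
    hshift (cosetMean K g), expect_cosetMean] at hmean
  linarith

lemma expect_sqrt_cosetMean_mul_le (hKH : K ≤ H) (hg : ∀ u, 0 ≤ g u) (e : G) :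
    𝔼 u, √(cosetMean K g u * cosetMean K g (u + e)) ≤
      𝔼 u, √(cosetMean H g u * cosetMean H g (u + e)) := by
  rw [← expect_cosetMean (H := H)]
  refine Finset.expect_le_expect fun u _ => ?_
  refine (cosetMean_sqrt_mul_le (cosetMean_nonneg hg) (fun _ => cosetMean_nonneg hg _) u).trans_eq
    ?_
  rw [cosetMean_comp_add_right, cosetMean_cosetMean_of_le hKH, cosetMean_cosetMean_of_le hKH]

end Step

lemma eq_zero_or_eq_one (b : ZMod 2) : b = 0 ∨ b = 1 := by
  decide +revert

/-- The words whose coordinates in `S` are zero. Two words agree on `S` exactly when they are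
congruent modulo this subgroup. -/
def vanishingOn {ι : Type*} (S : Set ι) : AddSubgroup (ι → ZMod 2) := AddSubgroup.pi S fun _ => ⊥

variable {ι : Type*}

lemma mem_vanishingOn {S : Set ι} {c : ι → ZMod 2} : c ∈ vanishingOn S ↔ ∀ i ∈ S, c i = 0 :=
  Iff.rfl

lemma vanishingOn_empty : vanishingOn (∅ : Set ι) = ⊤ := by
  ext c
  simp [mem_vanishingOn]

lemma vanishingOn_anti {S T : Set ι} (h : S ⊆ T) : vanishingOn T ≤ vanishingOn S :=
  fun _ hc i hi => hc i (h hi)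

lemma domRestrict_add_of_mem_vanishingOn {S T : Set ι} {c : ι → ZMod 2} (u : ι → ZMod 2)
    (hTS : T ⊆ S) (hc : c ∈ vanishingOn S) : T.domRestrict (u + c) = T.domRestrict u :=
  funext fun i => by
    rw [Set.domRestrict_apply, Set.domRestrict_apply, Pi.add_apply,
      mem_vanishingOn.1 hc i (hTS i.2), add_zero]

variable [Fintype ι] [LinearOrder ι] {g : (ι → ZMod 2) → ℝ}

/-- For the transition density `g = p(y | ·)` of a channel from words to `y`, with a uniform input,
this is the contribution of `y` to the Bhattacharyya parameter of the channel from the `i`-th bit to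
`y` and the previous bits. -/
def prefixBhattacharyya (g : (ι → ZMod 2) → ℝ) (i : ι) : ℝ :=
  𝔼 u, √(cosetMean (vanishingOn (Set.Iic i)) g u *
    cosetMean (vanishingOn (Set.Iic i)) g (u + Pi.single i 1))

lemma prefixBhattacharyya_nonneg (i : ι) : 0 ≤ prefixBhattacharyya g i :=
  Finset.expect_nonneg fun _ _ => Real.sqrt_nonneg _

lemma prefixBhattacharyya_le_expect (hg : ∀ u, 0 ≤ g u) (i : ι) :
    prefixBhattacharyya g i ≤ 𝔼 u, g u := by
  have hshift : 𝔼 u, cosetMean (vanishingOn (Set.Iic i)) g (u + Pi.single i 1) =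
      𝔼 u, cosetMean (vanishingOn (Set.Iic i)) g u :=
    Fintype.expect_equiv (Equiv.addRight (Pi.single i 1)) _ _ fun _ => rfl
  calc prefixBhattacharyya g i
      ≤ 𝔼 u, (cosetMean (vanishingOn (Set.Iic i)) g u +
          cosetMean (vanishingOn (Set.Iic i)) g (u + Pi.single i 1)) / 2 :=
        Finset.expect_le_expect fun _ _ =>
          sqrt_mul_le_half_add (cosetMean_nonneg hg _) (cosetMean_nonneg hg _)
    _ = 𝔼 u, g u := by
        rw [← Finset.expect_div, Finset.expect_add_distrib, hshift, expect_cosetMean,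
          add_self_div_two]

lemma expect_mul_log_cosetMean_vanishingOn_le (hg : ∀ u, 0 ≤ g u) (S : Finset ι) :
    𝔼 u, cosetMean (vanishingOn S) g u * Real.log (cosetMean (vanishingOn S) g u) ≤
      (𝔼 u, g u) * Real.log (𝔼 u, g u) +
        ∑ i ∈ S, 2 * (𝔼 u, g u - prefixBhattacharyya g i) := by
  induction S using Finset.induction_on_max with
  | empty => simp [vanishingOn_empty, cosetMean_top]
  | insert i T hT ih =>
    have hiT : i ∉ T := fun h => (hT i h).false
    have hsub : (insert i T : Set ι) ⊆ Set.Iic i :=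
      Set.insert_subset le_rfl fun j hj => (hT j hj).le
    have he : Pi.single i 1 ∈ vanishingOn (T : Set ι) := fun j hj => by
      simp [ne_of_mem_of_not_mem hj hiT]
    have hee : (Pi.single i 1 + Pi.single i 1 : ι → ZMod 2) = 0 := by
      rw [← Pi.single_add, CharTwo.add_self_eq_zero, Pi.single_zero]
    have hcover (h) (hh : h ∈ vanishingOn (T : Set ι)) :
        h ∈ vanishingOn (insert i T : Set ι) ∨
          h + Pi.single i 1 ∈ vanishingOn (insert i T : Set ι) := by
      rcases eq_zero_or_eq_one (h i) with hi | hi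
      · exact .inl (Set.forall_mem_insert.2 ⟨hi, hh⟩)
      · refine .inr (Set.forall_mem_insert.2 ⟨?_, add_mem hh he⟩)
        change h i + Pi.single (M := fun _ => ZMod 2) i 1 i = 0
        rw [hi, Pi.single_eq_same, CharTwo.add_self_eq_zero]
    have hstep := expect_mul_log_cosetMean_le (vanishingOn_anti (Set.subset_insert i T)) he
      (hee ▸ zero_mem _) hcover hg
    -- Knowing only the positions of `T` instead of all positions before `i` can only increase the
    -- Bhattacharyya parameter, by concavity of `(a, b) ↦ √(a * b)`.
    have hdegrade := expect_sqrt_cosetMean_mul_le (vanishingOn_anti hsub) hg (Pi.single i 1)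
    rw [Finset.sum_insert hiT, Finset.coe_insert, prefixBhattacharyya]
    linarith

end Entropy

section Divergence

open InformationTheory

variable {𝓧 𝓨 : Type*} [MeasurableSpace 𝓧] [MeasurableSpace 𝓨]

lemma klDiv_compProd_right_eq_lintegral [MeasurableSpace.CountableOrCountablyGenerated 𝓧 𝓨]
    (μ : Measure 𝓧) [IsFiniteMeasure μ] {κ η : Kernel 𝓧 𝓨} [IsMarkovKernel κ] [IsMarkovKernel η]
    (hκη : ∀ x, κ x ≪ η x) :
    klDiv (μ ⊗ₘ κ) (μ ⊗ₘ η) = ∫⁻ x, klDiv (κ x) (η x) ∂μ := by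
  have hac : μ ⊗ₘ κ ≪ μ ⊗ₘ η := Measure.AbsolutelyContinuous.compProd_right (.of_forall hκη)
  have hκ : κ = η.withDensity (κ.rnDeriv η) := by
    ext1 x
    rw [Kernel.withDensity_rnDeriv_eq (hκη x)]
  have hm : Measurable fun p : 𝓧 × 𝓨 => κ.rnDeriv η p.1 p.2 := κ.measurable_rnDeriv η
  have hrn : (μ ⊗ₘ κ).rnDeriv (μ ⊗ₘ η) =ᵐ[μ ⊗ₘ η] fun p => κ.rnDeriv η p.1 p.2 := by
    have hκ' : IsSFiniteKernel (η.withDensity (κ.rnDeriv η)) := hκ ▸ inferInstance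
    have heq : μ ⊗ₘ κ = (μ ⊗ₘ η).withDensity fun p => κ.rnDeriv η p.1 p.2 := by
      rw [← Measure.compProd_withDensity hm, ← hκ]
    rw [heq]
    exact Measure.rnDeriv_withDensity _ hm
  calc klDiv (μ ⊗ₘ κ) (μ ⊗ₘ η)
      = ∫⁻ p, ENNReal.ofReal (klFun (κ.rnDeriv η p.1 p.2).toReal) ∂(μ ⊗ₘ η) := by
        rw [klDiv_eq_lintegral_klFun_of_ac hac]
        exact lintegral_congr_ae (hrn.fun_comp fun r => ENNReal.ofReal (klFun r.toReal))
    _ = ∫⁻ x, ∫⁻ y, ENNReal.ofReal (klFun (κ.rnDeriv η x y).toReal) ∂η x ∂μ :=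
        Measure.lintegral_compProd (by fun_prop)
    _ = ∫⁻ x, klDiv (κ x) (η x) ∂μ := by
        refine lintegral_congr fun x => ?_
        rw [klDiv_eq_lintegral_klFun_of_ac (hκη x)]
        exact lintegral_congr_ae (Kernel.rnDeriv_eq_rnDeriv_measure.fun_comp
          fun r => ENNReal.ofReal (klFun r.toReal))

lemma klDiv_map_swap (μ ν : Measure (𝓧 × 𝓨)) [IsFiniteMeasure μ] [IsFiniteMeasure ν] :
    klDiv (μ.map Prod.swap) (ν.map Prod.swap) = klDiv μ ν := by
  refine (klDiv_map_le μ ν measurable_swap).antisymm ?_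
  simpa only [Measure.map_map measurable_swap measurable_swap, Prod.swap_swap_eq, Measure.map_id]
    using klDiv_map_le (μ.map Prod.swap) (ν.map Prod.swap) measurable_swap

lemma klDiv_prod_fst_snd_le [StandardBorelSpace 𝓧] [Nonempty 𝓧] (ρ : Measure (𝓧 × 𝓨))
    [IsProbabilityMeasure ρ] (ν : Measure 𝓨) [IsProbabilityMeasure ν] :
    klDiv ρ (ρ.fst.prod ρ.snd) ≤ klDiv ρ (ρ.fst.prod ν) := by
  have hρ : ρ.map Prod.swap = ρ.snd ⊗ₘ (ρ.map Prod.swap).condKernel := by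
    rw [← Measure.fst_map_swap, Measure.disintegrate]
  have hprod (ν : Measure 𝓨) [IsProbabilityMeasure ν] :
      (ρ.fst.prod ν).map Prod.swap = ν ⊗ₘ Kernel.const 𝓨 ρ.fst := by
    rw [Measure.prod_swap, Measure.compProd_const]
  -- By the chain rule the two sides differ by the divergence of `ρ.snd` from `ν`.
  rw [← klDiv_map_swap, ← klDiv_map_swap ρ, hprod, hprod, hρ, klDiv_compProd_eq_add ρ.snd ν]
  exact le_add_self

end Divergence

section Leakage

open InformationTheory

lemma card_mul_inv_card {α : Type*} [Fintype α] [Nonempty α] :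
    (Fintype.card α : ℝ≥0∞) * (Fintype.card α : ℝ≥0∞)⁻¹ = 1 :=
  ENNReal.mul_inv_cancel (by simp) (by simp)

variable {G 𝓨 : Type*} [AddCommGroup G] [Fintype G] [MeasurableSpace G] [DiscreteMeasurableSpace G]
  [MeasurableSpace 𝓨]

open Classical in
/-- The channel that adds to its input a uniform element of `H` before applying `κ`; the analogue
for channels of `cosetMean`. -/
def cosetMeanKernel (H : AddSubgroup G) (κ : Kernel G 𝓨) : Kernel G 𝓨 :=
  Kernel.ofFunOfCountable fun u => ∑ h : H, (Fintype.card H : ℝ≥0∞)⁻¹ • κ (u + h)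

variable {H : AddSubgroup G} {κ : Kernel G 𝓨}

open Classical in
lemma cosetMeanKernel_apply (u : G) :
    cosetMeanKernel H κ u = ∑ h : H, (Fintype.card H : ℝ≥0∞)⁻¹ • κ (u + h) := rfl

instance [IsMarkovKernel κ] : IsMarkovKernel (cosetMeanKernel H κ) where
  isProbabilityMeasure u := ⟨by simp [cosetMeanKernel_apply, card_mul_inv_card]⟩

lemma cosetMeanKernel_absolutelyContinuous_top (u : G) :
    cosetMeanKernel H κ u ≪ cosetMeanKernel ⊤ κ u := by
  intro s hs
  simp only [cosetMeanKernel_apply, Measure.finsetSum_apply, Measure.smul_apply, smul_eq_mul,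
    Finset.sum_eq_zero_iff, mul_eq_zero, ENNReal.inv_eq_zero, ENNReal.natCast_ne_top, false_or,
    Finset.mem_univ, true_imp_iff] at hs ⊢
  exact fun h => hs ⟨h, AddSubgroup.mem_top _⟩

lemma cosetMeanKernel_top_apply_eq (u v : G) :
    cosetMeanKernel ⊤ κ u = cosetMeanKernel ⊤ κ v := by
  classical
  simp only [cosetMeanKernel_apply]
  exact Fintype.sum_equiv (Equiv.addLeft (⟨u - v, AddSubgroup.mem_top _⟩ : (⊤ : AddSubgroup G))) _ _
    fun h => by simp [← add_assoc]

lemma map_compProd_cosetMeanKernel {γ : Type*} [MeasurableSpace γ] [IsMarkovKernel κ]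
    {μ : Measure G} [SFinite μ] (hμ : ∀ h ∈ H, MeasurePreserving (· + h) μ μ)
    {r : G → γ} (hr : ∀ u, ∀ h ∈ H, r (u + h) = r u) :
    (μ ⊗ₘ cosetMeanKernel H κ).map (Prod.map r id) = (μ ⊗ₘ κ).map (Prod.map r id) := by
  classical
  have hrm : Measurable (Prod.map r (id : 𝓨 → 𝓨)) := Measurable.of_discrete.prodMap measurable_id
  ext s hs
  rw [Measure.map_apply hrm hs, Measure.map_apply hrm hs, Measure.compProd_apply (hrm hs),
    Measure.compProd_apply (hrm hs)]
  set F : G → ℝ≥0∞ := fun u => κ u (Prod.mk u ⁻¹' (Prod.map r id ⁻¹' s)) with hF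
  have hshift (h : H) :
      ∫⁻ u, κ (u + h) (Prod.mk u ⁻¹' (Prod.map r id ⁻¹' s)) ∂μ = ∫⁻ u, F u ∂μ := by
    refine Eq.trans (lintegral_congr fun u => ?_) ((hμ h h.2).lintegral_comp .of_discrete)
    simp only [hF, Set.preimage, Set.mem_ofPred_eq, Prod.map_apply, hr u h h.2]
  simp only [cosetMeanKernel_apply, Measure.finsetSum_apply, Measure.smul_apply, smul_eq_mul]
  rw [lintegral_finsetSum _ fun _ _ => .of_discrete]
  simp_rw [lintegral_const_mul _ Measurable.of_discrete, hshift]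
  rw [Finset.sum_const, nsmul_eq_mul, Finset.card_univ, ← mul_assoc, card_mul_inv_card, one_mul]

lemma klDiv_map_prodMk_le {Ω γ : Type*} [MeasurableSpace Ω] [MeasurableSpace γ]
    [StandardBorelSpace γ] [Nonempty γ] [IsMarkovKernel κ] {P : Measure Ω} [IsProbabilityMeasure P]
    {U : Ω → G} {Z : Ω → 𝓨} (hU : Measurable U) (hZ : Measurable Z) (hUZ : HasCondDistrib Z U κ P)
    (hUH : ∀ h ∈ H, MeasurePreserving (· + h) (P.map U) (P.map U))
    {r : G → γ} (hr : ∀ u, ∀ h ∈ H, r (u + h) = r u) :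
    klDiv (P.map fun ω => (r (U ω), Z ω)) ((P.map fun ω => r (U ω)).prod (P.map Z)) ≤
      klDiv (P.map U ⊗ₘ cosetMeanKernel H κ) (P.map U ⊗ₘ cosetMeanKernel ⊤ κ) := by
  have hrm : Measurable r := .of_discrete
  have hrU : Measurable fun ω => r (U ω) := hrm.comp hU
  have := Measure.isProbabilityMeasure_map (μ := P) hU.aemeasurable
  have hjoint : P.map (fun ω => (r (U ω), Z ω)) =
      (P.map U ⊗ₘ cosetMeanKernel H κ).map (Prod.map r id) := by
    rw [map_compProd_cosetMeanKernel hUH hr, ← hUZ.map_eq,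
      Measure.map_map (hrm.prodMap measurable_id) (hU.prodMk hZ)]
    rfl
  have hprod : (P.map fun ω => r (U ω)).prod (cosetMeanKernel ⊤ κ 0) =
      (P.map U ⊗ₘ cosetMeanKernel ⊤ κ).map (Prod.map r id) := by
    have hconst : cosetMeanKernel ⊤ κ = Kernel.const G (cosetMeanKernel ⊤ κ 0) :=
      Kernel.ext fun u => cosetMeanKernel_top_apply_eq u 0
    rw [hconst, Measure.compProd_const, ← Measure.map_prod_map _ _ hrm measurable_id,
      Measure.map_id, Measure.map_map hrm hU]
    rfl
  have hfst : (P.map fun ω => (r (U ω), Z ω)).fst = P.map fun ω => r (U ω) :=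
    Measure.fst_map_prodMk hZ
  have hsnd : (P.map fun ω => (r (U ω), Z ω)).snd = P.map Z := Measure.snd_map_prodMk hrU
  have := Measure.isProbabilityMeasure_map (μ := P) (hrU.prodMk hZ).aemeasurable
  calc klDiv (P.map fun ω => (r (U ω), Z ω)) ((P.map fun ω => r (U ω)).prod (P.map Z))
      ≤ klDiv (P.map fun ω => (r (U ω), Z ω))
          ((P.map fun ω => r (U ω)).prod (cosetMeanKernel ⊤ κ 0)) := by
        rw [← hfst, ← hsnd]
        exact klDiv_prod_fst_snd_le _ _
    _ ≤ klDiv (P.map U ⊗ₘ cosetMeanKernel H κ) (P.map U ⊗ₘ cosetMeanKernel ⊤ κ) := by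
        rw [hjoint, hprod]
        exact klDiv_map_le _ _ (hrm.prodMap measurable_id)

/-- Translating the input amounts to applying a map to the output. This is the symmetry that a
product of binary-input symmetric channels has with respect to its input word. -/
def IsTranslationCovariant (κ : Kernel G 𝓨) : Prop :=
  ∀ a, ∃ π : 𝓨 → 𝓨, Measurable π ∧ ∀ u, κ (u + a) = (κ u).map π

lemma klDiv_cosetMeanKernel_le (hκ : IsTranslationCovariant κ) [IsMarkovKernel κ] (u v : G) :
    klDiv (cosetMeanKernel H κ u) (cosetMeanKernel ⊤ κ u) ≤
      klDiv (cosetMeanKernel H κ v) (cosetMeanKernel ⊤ κ v) := by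
  obtain ⟨π, hπ, hκπ⟩ := hκ (u - v)
  have hmap (K : AddSubgroup G) : cosetMeanKernel K κ u = (cosetMeanKernel K κ v).map π := by
    rw [cosetMeanKernel_apply, cosetMeanKernel_apply, Measure.map_finset_sum hπ.aemeasurable]
    simp only [Measure.map_smul, ← hκπ]
    refine Finset.sum_congr rfl fun h _ => ?_
    rw [add_right_comm, add_sub_cancel]
  rw [hmap, hmap]
  exact klDiv_map_le _ _ hπ

lemma klDiv_compProd_cosetMeanKernel_le (hκ : IsTranslationCovariant κ) [IsMarkovKernel κ]
    (μ : Measure G) [IsProbabilityMeasure μ] (v : G) :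
    klDiv (μ ⊗ₘ cosetMeanKernel H κ) (μ ⊗ₘ cosetMeanKernel ⊤ κ) ≤
      klDiv (cosetMeanKernel H κ v) (cosetMeanKernel ⊤ κ v) := by
  rw [klDiv_compProd_right_eq_lintegral μ cosetMeanKernel_absolutelyContinuous_top]
  calc ∫⁻ u, klDiv (cosetMeanKernel H κ u) (cosetMeanKernel ⊤ κ u) ∂μ
      ≤ ∫⁻ _u, klDiv (cosetMeanKernel H κ v) (cosetMeanKernel ⊤ κ v) ∂μ :=
        lintegral_mono fun u => klDiv_cosetMeanKernel_le hκ u v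
    _ = klDiv (cosetMeanKernel H κ v) (cosetMeanKernel ⊤ κ v) := by simp

end Leakage

section Density

open InformationTheory

/-- `ν` has the density `p`, everywhere nonnegative and finite, with respect to `μ`. Pointwise
nonnegativity lets inequalities between densities be proved one output at a time. -/
structure HasDensity {𝓨 : Type*} [MeasurableSpace 𝓨] (ν μ : Measure 𝓨) (p : 𝓨 → ℝ) : Prop where
  measurable : Measurable p
  nonneg : 0 ≤ p
  eq_withDensity : ν = μ.withDensity fun y => ENNReal.ofReal (p y)

variable {𝓨 𝓩 : Type*} [MeasurableSpace 𝓨] [MeasurableSpace 𝓩] {μ ν ν' : Measure 𝓨}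
  {p q : 𝓨 → ℝ}

lemma hasDensity_toReal_rnDeriv [IsFiniteMeasure ν] [SigmaFinite μ] (h : ν ≪ μ) :
    HasDensity ν μ fun y => (ν.rnDeriv μ y).toReal where
  measurable := by fun_prop
  nonneg _ := ENNReal.toReal_nonneg
  eq_withDensity := by
    rw [← Measure.withDensity_rnDeriv_eq ν μ h]
    refine withDensity_congr_ae ?_
    rw [Measure.withDensity_rnDeriv_eq ν μ h]
    filter_upwards [Measure.rnDeriv_lt_top ν μ] with y hy
    rw [ENNReal.ofReal_toReal hy.ne]

lemma exists_hasDensity {α : Type*} [Finite α] [MeasurableSpace α] (κ : Kernel α 𝓨)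
    [IsFiniteKernel κ] : ∃ (μ : Measure 𝓨) (p : α → 𝓨 → ℝ), IsFiniteMeasure μ ∧
      ∀ x, HasDensity (κ x) μ (p x) := by
  have := Fintype.ofFinite α
  refine ⟨∑ x, κ x, _, inferInstance, fun x => hasDensity_toReal_rnDeriv ?_⟩
  exact Measure.absolutelyContinuous_of_le
    (Finset.single_le_sum (fun y _ => Measure.zero_le (κ y)) (Finset.mem_univ x))

lemma hasDensity_dirac_count [Countable 𝓨] [MeasurableSingletonClass 𝓨] (c : 𝓨) :
    HasDensity (Measure.dirac c) Measure.count (Set.indicator {c} 1) where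
  measurable := .of_discrete
  nonneg := Set.indicator_nonneg fun _ _ => zero_le_one
  eq_withDensity := by
    refine Measure.ext_of_singleton fun d => ?_
    rw [withDensity_apply _ (measurableSet_singleton d), lintegral_singleton,
      Measure.dirac_apply' _ (measurableSet_singleton d)]
    rcases eq_or_ne d c with rfl | h
    · simp
    · simp [h, h.symm]

lemma mul_klFun_div {a b : ℝ} (h : b = 0 → a = 0) :
    b * klFun (a / b) = a * Real.log a - a * Real.log b + b - a := by
  by_cases hb : b = 0
  · simp [hb, h hb]
  by_cases ha : a = 0
  · simp [ha, klFun]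
  rw [klFun, Real.log_div ha hb]
  field_simp

lemma mul_log_sub_mul_log_add_sub_nonneg {a b : ℝ} (ha : 0 ≤ a) (hb : 0 ≤ b) (h : b = 0 → a = 0) :
    0 ≤ a * Real.log a - a * Real.log b + b - a := by
  rw [← mul_klFun_div h]
  exact mul_nonneg hb (klFun_nonneg (div_nonneg ha hb))

namespace HasDensity

lemma finset_sum {ι : Type*} {s : Finset ι} {ν : ι → Measure 𝓨} {p : ι → 𝓨 → ℝ}
    (h : ∀ i ∈ s, HasDensity (ν i) μ (p i)) :
    HasDensity (∑ i ∈ s, ν i) μ fun y => ∑ i ∈ s, p i y where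
  measurable := Finset.measurable_fun_sum s fun i hi => (h i hi).measurable
  nonneg y := Finset.sum_nonneg fun i hi => (h i hi).nonneg y
  eq_withDensity := by
    ext t ht
    rw [withDensity_apply _ ht, Measure.finsetSum_apply,
      lintegral_congr fun y => ENNReal.ofReal_sum_of_nonneg fun i hi => (h i hi).nonneg y,
      lintegral_finsetSum' _ fun i hi => (h i hi).measurable.ennreal_ofReal.aemeasurable]
    refine Finset.sum_congr rfl fun i hi => ?_
    rw [(h i hi).eq_withDensity, withDensity_apply _ ht]

lemma const_smul (h : HasDensity ν μ p) {c : ℝ≥0∞} (hc : c ≠ ∞) :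
    HasDensity (c • ν) μ fun y => c.toReal * p y where
  measurable := h.measurable.const_mul _
  nonneg y := mul_nonneg ENNReal.toReal_nonneg (h.nonneg y)
  eq_withDensity := by
    simp_rw [ENNReal.ofReal_mul ENNReal.toReal_nonneg, ENNReal.ofReal_toReal hc]
    rw [h.eq_withDensity, ← withDensity_smul _ h.measurable.ennreal_ofReal]
    rfl

lemma prod {ρ σ : Measure 𝓩} {q : 𝓩 → ℝ} [SFinite σ] (h : HasDensity ν μ p)
    (hρ : HasDensity ρ σ q) :
    HasDensity (ν.prod ρ) (μ.prod σ) fun x => p x.1 * q x.2 where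
  measurable := (h.measurable.comp measurable_fst).mul (hρ.measurable.comp measurable_snd)
  nonneg x := mul_nonneg (h.nonneg _) (hρ.nonneg _)
  eq_withDensity := by
    rw [h.eq_withDensity, hρ.eq_withDensity,
      prod_withDensity h.measurable.ennreal_ofReal hρ.measurable.ennreal_ofReal]
    simp_rw [ENNReal.ofReal_mul (h.nonneg _)]

lemma lintegral_eq (h : HasDensity ν μ p) : ∫⁻ y, ENNReal.ofReal (p y) ∂μ = ν Set.univ := by
  rw [h.eq_withDensity, withDensity_apply _ .univ, setLIntegral_univ]

lemma integrable [IsFiniteMeasure ν] (h : HasDensity ν μ p) : Integrable p μ := by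
  refine ⟨h.measurable.aestronglyMeasurable, ?_⟩
  rw [hasFiniteIntegral_iff_ofReal (.of_forall h.nonneg), h.lintegral_eq]
  exact measure_lt_top _ _

lemma integral_eq_one [IsProbabilityMeasure ν] (h : HasDensity ν μ p) : ∫ y, p y ∂μ = 1 := by
  rw [integral_eq_lintegral_of_nonneg_ae (.of_forall h.nonneg) h.measurable.aestronglyMeasurable,
    h.lintegral_eq, measure_univ, ENNReal.toReal_one]

lemma eq_withDensity_div (hp : HasDensity ν μ p) (hq : HasDensity ν' μ q)
    (hpq : ∀ y, q y = 0 → p y = 0) :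
    ν = ν'.withDensity fun y => ENNReal.ofReal (p y / q y) := by
  have hpm := hp.measurable
  have hqm := hq.measurable
  rw [hp.eq_withDensity, hq.eq_withDensity, ← withDensity_mul _ (by fun_prop) (by fun_prop)]
  refine congrArg _ (funext fun y => ?_)
  rw [Pi.mul_apply, ← ENNReal.ofReal_mul (hq.nonneg y), mul_div_cancel_of_imp' (hpq y)]

lemma toReal_rnDeriv_ae_eq [SigmaFinite ν'] (hp : HasDensity ν μ p) (hq : HasDensity ν' μ q)
    (hpq : ∀ y, q y = 0 → p y = 0) :
    ∀ᵐ y ∂ν', (ν.rnDeriv ν' y).toReal = p y / q y := by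
  have h := Measure.rnDeriv_withDensity ν' (hp.measurable.div hq.measurable).ennreal_ofReal
  simp only [Pi.div_apply] at h
  rw [← hp.eq_withDensity_div hq hpq] at h
  filter_upwards [h] with y hy
  rw [hy, ENNReal.toReal_ofReal (div_nonneg (hp.nonneg y) (hq.nonneg y))]

lemma klDiv_eq_lintegral [IsFiniteMeasure ν] [IsFiniteMeasure ν'] (hp : HasDensity ν μ p)
    (hq : HasDensity ν' μ q) (hpq : ∀ y, q y = 0 → p y = 0) :
    klDiv ν ν' =
      ∫⁻ y, ENNReal.ofReal (p y * Real.log (p y) - p y * Real.log (q y) + q y - p y) ∂μ := by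
  have hac : ν ≪ ν' := by
    rw [hp.eq_withDensity_div hq hpq]
    exact withDensity_absolutelyContinuous _ _
  have hm : Measurable fun y => ENNReal.ofReal (klFun (p y / q y)) :=
    (measurable_klFun.comp (hp.measurable.div hq.measurable)).ennreal_ofReal
  rw [klDiv_eq_lintegral_klFun_of_ac hac, lintegral_congr_ae
    ((hp.toReal_rnDeriv_ae_eq hq hpq).mono fun y hy => congrArg (ENNReal.ofReal <| klFun ·) hy),
    hq.eq_withDensity, lintegral_withDensity_eq_lintegral_mul _ hq.measurable.ennreal_ofReal hm]
  refine lintegral_congr fun y => ?_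
  rw [Pi.mul_apply, ← ENNReal.ofReal_mul (hq.nonneg y), mul_klFun_div (hpq y)]

end HasDensity

lemma bhattacharyya_eq_integral [SigmaFinite μ] {W : Kernel (ZMod 2) 𝓨} {p : ZMod 2 → 𝓨 → ℝ}
    (h : ∀ b, HasDensity (W b) μ (p b)) : bhattacharyya W = ∫ y, √(p 0 y * p 1 y) ∂μ := by
  have hsum : HasDensity (W 0 + W 1) μ fun y => p 0 y + p 1 y := by
    simpa using HasDensity.finset_sum (s := {0, 1}) fun b _ => h b
  have : SigmaFinite (W 0 + W 1) := hsum.eq_withDensity ▸ SigmaFinite.withDensity_ofReal _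
  have hrn (b) : ∀ᵐ y ∂(W 0 + W 1), ((W b).rnDeriv (W 0 + W 1) y).toReal =
      p b y / (p 0 y + p 1 y) := by
    refine (h b).toReal_rnDeriv_ae_eq hsum fun y hy => ?_
    obtain ⟨h0, h1⟩ := (add_eq_zero_iff_of_nonneg ((h 0).nonneg y) ((h 1).nonneg y)).1 hy
    rcases eq_zero_or_eq_one b with rfl | rfl
    exacts [h0, h1]
  calc bhattacharyya W
      = ∫ y, √(p 0 y * p 1 y) / (p 0 y + p 1 y) ∂(W 0 + W 1) := by
        refine integral_congr_ae ?_
        filter_upwards [hrn 0, hrn 1] with y h0 h1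
        rw [h0, h1, div_mul_div_comm, Real.sqrt_div' _ (mul_self_nonneg _),
          Real.sqrt_mul_self (hsum.nonneg y)]
    _ = ∫ y, √(p 0 y * p 1 y) ∂μ := by
        rw [hsum.eq_withDensity, integral_withDensity_eq_integral_toReal_smul
          hsum.measurable.ennreal_ofReal (.of_forall fun _ => ENNReal.ofReal_lt_top)]
        refine integral_congr_ae (.of_forall fun y => ?_)
        simp only [smul_eq_mul]
        rw [ENNReal.toReal_ofReal (hsum.nonneg y), mul_div_cancel_of_imp']
        intro hy
        rw [((add_eq_zero_iff_of_nonneg ((h 0).nonneg y) ((h 1).nonneg y)).1 hy).1, zero_mul,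
          Real.sqrt_zero]

end Density

section Subchannel

section Fiber

variable {G Q : Type*} [AddCommGroup G] [Fintype G] {H : AddSubgroup G} {ρ : G → Q}

lemma sum_fiber_eq_card_mul_cosetMean [DecidableEq Q] (hρ : ∀ u v, ρ v = ρ u ↔ v - u ∈ H)
    (g : G → ℝ) (u : G) :
    ∑ v with ρ v = ρ u, g v = Nat.card H * cosetMean H g u := by
  classical
  rw [cosetMean, Fintype.expect_eq_sum_div_card, Nat.card_eq_fintype_card,
    mul_div_cancel₀ _ (Nat.cast_ne_zero.2 Fintype.card_ne_zero)]
  symm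
  refine Finset.sum_bij (fun h _ => u + h) (fun h _ => ?_) (fun h _ k _ hhk => ?_)
    (fun v hv => ?_) fun _ _ => rfl
  · simp [hρ]
  · exact Subtype.ext (add_left_cancel hhk)
  · exact ⟨⟨v - u, (hρ u v).1 (Finset.mem_filter.1 hv).2⟩, Finset.mem_univ _, add_sub_cancel u v⟩

lemma sum_comp_eq_card_mul_sum [Fintype Q] (hρ : ∀ u v, ρ v = ρ u ↔ v - u ∈ H)
    (hsurj : ρ.Surjective) (F : Q → ℝ) : ∑ u, F (ρ u) = Nat.card H * ∑ q, F q := by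
  classical
  have hcard (q : Q) : ((Finset.univ.filter fun u => ρ u = q).card : ℝ) = Nat.card H := by
    obtain ⟨u, rfl⟩ := hsurj q
    simpa [cosetMean] using sum_fiber_eq_card_mul_cosetMean hρ 1 u
  rw [← Finset.sum_fiberwise Finset.univ ρ, Finset.mul_sum]
  refine Finset.sum_congr rfl fun q _ => ?_
  rw [Finset.sum_congr rfl fun u hu => congrArg F (Finset.mem_filter.1 hu).2, Finset.sum_const,
    nsmul_eq_mul, hcard]

end Fiber

section Prefix

variable {ι : Type*} [LinearOrder ι]

/-- The bits of the word `u` before position `i`, and its bit at `i`. -/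
def prefixAndBit (i : ι) (u : ι → ZMod 2) : ({j : ι // j < i} → ZMod 2) × ZMod 2 :=
  (fun j => u j, u i)

lemma prefixAndBit_eq_iff (i : ι) (u v : ι → ZMod 2) :
    prefixAndBit i v = prefixAndBit i u ↔ v - u ∈ vanishingOn (Set.Iic i) := by
  simp [prefixAndBit, mem_vanishingOn, sub_eq_zero, le_iff_lt_or_eq, funext_iff, or_imp,
    forall_and]

lemma prefixAndBit_surjective (i : ι) : (prefixAndBit i).Surjective := fun q =>
  ⟨fun j => if h : j < i then q.1 ⟨j, h⟩ else q.2,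
    Prod.ext (funext fun j => by simp [prefixAndBit, j.2]) (by simp [prefixAndBit])⟩

lemma prefixAndBit_add_single (i : ι) (u : ι → ZMod 2) :
    prefixAndBit i (u + Pi.single i 1) = ((prefixAndBit i u).1, (prefixAndBit i u).2 + 1) :=
  Prod.ext (funext fun j => by simp [prefixAndBit, j.2.ne]) (by simp [prefixAndBit])

lemma sqrt_mul_mul_mul_self {c : ℝ} (hc : 0 ≤ c) (a b : ℝ) :
    √(c * a * (c * b)) = c * √(a * b) := by
  rw [mul_mul_mul_comm, Real.sqrt_mul (mul_self_nonneg c), Real.sqrt_mul_self hc]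

variable [Fintype ι]

/-- The transition density of the channel from the `i`-th bit `b` to the output and the previous
bits `w`, for a word channel with transition density `g` at the given output. -/
def prefixDensity (g : (ι → ZMod 2) → ℝ) (i : ι) (b : ZMod 2) (w : {j : ι // j < i} → ZMod 2) : ℝ :=
  (2 ^ (Fintype.card ι - 1))⁻¹ * ∑ u with prefixAndBit i u = (w, b), g u

lemma sum_sqrt_prefixDensity (g : (ι → ZMod 2) → ℝ) (i : ι) :
    ∑ w, √(prefixDensity g i 0 w * prefixDensity g i 1 w) = prefixBhattacharyya g i := by
  set H := vanishingOn (Set.Iic i)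
  set T : ({j : ι // j < i} → ZMod 2) × ZMod 2 → ℝ := fun q => ∑ u with prefixAndBit i u = q, g u
  have hH : (0 : ℝ) < Nat.card H := Nat.cast_pos.2 Nat.card_pos
  have hT (u) : T (prefixAndBit i u) = Nat.card H * cosetMean H g u :=
    sum_fiber_eq_card_mul_cosetMean (prefixAndBit_eq_iff i) g u
  have hpow : (2 : ℝ) ^ Fintype.card ι = 2 * 2 ^ (Fintype.card ι - 1) := by
    have : Nonempty ι := ⟨i⟩
    rw [mul_pow_sub_one Fintype.card_ne_zero]
  have hterm (u) : √(cosetMean H g u * cosetMean H g (u + Pi.single i 1)) =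
      √(T (prefixAndBit i u) *
        T ((prefixAndBit i u).1, (prefixAndBit i u).2 + 1)) / Nat.card H := by
    rw [← prefixAndBit_add_single, hT, hT, sqrt_mul_mul_mul_self hH.le,
      mul_div_cancel_left₀ _ hH.ne']
  have hbits (w) : ∑ b, √(T (w, b) * T (w, b + 1)) = 2 * √(T (w, 0) * T (w, 1)) := by
    refine (Fin.sum_univ_two fun b : ZMod 2 => √(T (w, b) * T (w, b + 1))).trans ?_
    rw [two_mul]
    exact congrArg (_ + √·) (mul_comm (T (w, 1)) _)
  calc ∑ w, √(prefixDensity g i 0 w * prefixDensity g i 1 w)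
      = (2 ^ (Fintype.card ι - 1))⁻¹ * ∑ w, √(T (w, 0) * T (w, 1)) := by
        rw [Finset.mul_sum]
        exact Finset.sum_congr rfl fun w _ => sqrt_mul_mul_mul_self (by positivity) _ _
    _ = (∑ q, √(T q * T (q.1, q.2 + 1))) / 2 ^ Fintype.card ι := by
        simp only [Fintype.sum_prod_type, hbits, ← Finset.mul_sum, hpow]
        field_simp
    _ = prefixBhattacharyya g i := by
        rw [prefixBhattacharyya, Fintype.expect_eq_sum_div_card,
          Finset.sum_congr rfl fun u _ => hterm u, ← Finset.sum_div,
          sum_comp_eq_card_mul_sum (prefixAndBit_eq_iff i) (prefixAndBit_surjective i)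
            fun q => √(T q * T (q.1, q.2 + 1)), mul_div_cancel_left₀ _ hH.ne']
        simp

end Prefix

variable {𝓨 : Type*} [MeasurableSpace 𝓨] {W : Kernel (ZMod 2) 𝓨} {m : ℕ}

lemma subchannel_apply (i : Fin (2 ^ m)) (b : ZMod 2) :
    subchannel W m i b = ∑ u : Fin (2 ^ m) → ZMod 2 with u i = b, ((2 : ℝ≥0∞) ^ (2 ^ m - 1))⁻¹ •
      (combinedChannel W m u).prod (Measure.dirac fun j : {j // j < i} => u j) := rfl

lemma hasDensity_subchannel {μ : Measure (Fin (2 ^ m) → 𝓨)}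
    {p : (Fin (2 ^ m) → ZMod 2) → (Fin (2 ^ m) → 𝓨) → ℝ}
    (hp : ∀ u, HasDensity (combinedChannel W m u) μ (p u)) (i : Fin (2 ^ m)) (b : ZMod 2) :
    HasDensity (subchannel W m i b) (μ.prod Measure.count)
      fun x => prefixDensity (p · x.1) i b x.2 := by
  have hc : ((2 : ℝ≥0∞) ^ (2 ^ m - 1))⁻¹ ≠ ∞ := by simp
  rw [subchannel_apply]
  convert HasDensity.finset_sum fun u (_ : u ∈ Finset.univ.filter fun u => u i = b) =>
    ((hp u).prod (hasDensity_dirac_count fun j : {j // j < i} => u j)).const_smul hc using 1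
  ext x
  simp [prefixDensity, prefixAndBit, Finset.mul_sum, Set.indicator_apply, Finset.sum_filter,
    ← ite_and, eq_comm, and_comm]

lemma isFiniteMeasure_subchannel [IsMarkovKernel W] (i : Fin (2 ^ m)) (b : ZMod 2) :
    IsFiniteMeasure (subchannel W m i b) where
  measure_univ_lt_top := by
    rw [subchannel_apply]
    simp [ENNReal.mul_lt_top_iff, pos_iff_ne_zero]

lemma bhattacharyya_subchannel [IsMarkovKernel W] {μ : Measure (Fin (2 ^ m) → 𝓨)} [SigmaFinite μ]
    {p : (Fin (2 ^ m) → ZMod 2) → (Fin (2 ^ m) → 𝓨) → ℝ}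
    (hp : ∀ u, HasDensity (combinedChannel W m u) μ (p u)) (i : Fin (2 ^ m)) :
    bhattacharyya (subchannel W m i) = ∫ y, prefixBhattacharyya (p · y) i ∂μ := by
  have hd := hasDensity_subchannel hp i
  have hfin := isFiniteMeasure_subchannel (W := W) i
  have hint : Integrable (fun x : (Fin (2 ^ m) → 𝓨) × ({j // j < i} → ZMod 2) =>
      √(prefixDensity (p · x.1) i 0 x.2 * prefixDensity (p · x.1) i 1 x.2))
      (μ.prod Measure.count) := by
    refine (((hd 0).integrable.add (hd 1).integrable).div_const 2).mono'
      ((hd 0).measurable.mul (hd 1).measurable).sqrt.aestronglyMeasurable (.of_forall fun x => ?_)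
    rw [Real.norm_of_nonneg (Real.sqrt_nonneg _)]
    exact sqrt_mul_le_half_add ((hd 0).nonneg x) ((hd 1).nonneg x)
  rw [bhattacharyya_eq_integral hd, integral_prod _ hint]
  simp only [integral_count, sum_sqrt_prefixDensity]

end Subchannel

section WordChannel

open InformationTheory

section CosetMeanKernel

variable {G 𝓨 : Type*} [AddCommGroup G] [Fintype G] [MeasurableSpace G] [DiscreteMeasurableSpace G]
  [MeasurableSpace 𝓨] {H : AddSubgroup G} {κ : Kernel G 𝓨} {μ : Measure 𝓨} {p : G → 𝓨 → ℝ}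

lemma hasDensity_cosetMeanKernel (hp : ∀ u, HasDensity (κ u) μ (p u)) (u : G) :
    HasDensity (cosetMeanKernel H κ u) μ fun y => cosetMean H (p · y) u := by
  classical
  rw [cosetMeanKernel_apply]
  convert HasDensity.finset_sum fun (h : H) (_ : h ∈ Finset.univ) => (hp (u + h)).const_smul
    (ENNReal.inv_ne_top.2 (Nat.cast_ne_zero.2 (Fintype.card_ne_zero (α := H)))) using 2 with y
  rw [cosetMean, Fintype.expect_eq_sum_div_card, ← Finset.mul_sum, ENNReal.toReal_inv,
    ENNReal.toReal_natCast, div_eq_inv_mul]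

lemma le_lintegral_ofReal_expect {α : Type*} [Fintype α] [Nonempty α] {k : α → 𝓨 → ℝ}
    (hk : ∀ a y, 0 ≤ k a y) (hkm : ∀ a, Measurable (k a)) {D : ℝ≥0∞}
    (hD : ∀ a, D ≤ ∫⁻ y, ENNReal.ofReal (k a y) ∂μ) :
    D ≤ ∫⁻ y, ENNReal.ofReal (𝔼 a, k a y) ∂μ := by
  calc D = (Fintype.card α : ℝ≥0∞)⁻¹ * ∑ _a : α, D := by
        rw [Finset.sum_const, Finset.card_univ, nsmul_eq_mul, ← mul_assoc, mul_comm _⁻¹,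
          card_mul_inv_card, one_mul]
    _ ≤ (Fintype.card α : ℝ≥0∞)⁻¹ * ∑ a, ∫⁻ y, ENNReal.ofReal (k a y) ∂μ := by
        gcongr with a
        exact hD a
    _ = ∫⁻ y, ENNReal.ofReal (𝔼 a, k a y) ∂μ := by
        rw [← lintegral_finsetSum _ fun a _ => (hkm a).ennreal_ofReal,
          ← lintegral_const_mul _ (Finset.measurable_sum _ fun a _ => (hkm a).ennreal_ofReal)]
        refine lintegral_congr fun y => ?_
        rw [Fintype.expect_eq_sum_div_card, div_eq_inv_mul, ENNReal.ofReal_mul (by positivity),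
          ENNReal.ofReal_inv_of_pos (by positivity), ENNReal.ofReal_natCast,
          ENNReal.ofReal_sum_of_nonneg fun a _ => hk a y]

lemma klDiv_compProd_cosetMeanKernel_le_lintegral [IsMarkovKernel κ] (hκ : IsTranslationCovariant κ)
    (hp : ∀ u, HasDensity (κ u) μ (p u)) (P : Measure G) [IsProbabilityMeasure P] :
    klDiv (P ⊗ₘ cosetMeanKernel H κ) (P ⊗ₘ cosetMeanKernel ⊤ κ) ≤
      ∫⁻ y, ENNReal.ofReal (𝔼 u, cosetMean H (p · y) u * Real.log (cosetMean H (p · y) u) -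
        (𝔼 u, p u y) * Real.log (𝔼 u, p u y)) ∂μ := by
  set D := klDiv (P ⊗ₘ cosetMeanKernel H κ) (P ⊗ₘ cosetMeanKernel ⊤ κ)
  set c := fun u y => cosetMean H (p · y) u
  set q := fun y => 𝔼 u, p u y
  have hc (u) : HasDensity (cosetMeanKernel H κ u) μ (c u) := hasDensity_cosetMeanKernel hp u
  have hq (u) : HasDensity (cosetMeanKernel ⊤ κ u) μ q := by
    simpa only [cosetMean_top] using hasDensity_cosetMeanKernel (H := ⊤) hp u
  have hcq (u y) : q y = 0 → c u y = 0 := fun h =>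
    cosetMean_eq_zero_of_expect_eq_zero (fun v => (hp v).nonneg y) h u
  set k := fun u y => c u y * Real.log (c u y) - c u y * Real.log (q y) + q y - c u y
  have hk (u y) : 0 ≤ k u y :=
    mul_log_sub_mul_log_add_sub_nonneg ((hc u).nonneg y) ((hq u).nonneg y) (hcq u y)
  have hkm (u) : Measurable (k u) := by
    have := (hc u).measurable
    have := (hq u).measurable
    fun_prop
  have hD (u) : D ≤ ∫⁻ y, ENNReal.ofReal (k u y) ∂μ :=
    (klDiv_compProd_cosetMeanKernel_le hκ P u).trans_eq
      ((hc u).klDiv_eq_lintegral (hq u) (hcq u))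
  have hsum (y) : 𝔼 u, k u y = 𝔼 u, c u y * Real.log (c u y) - q y * Real.log (q y) := by
    simp only [k, Finset.expect_sub_distrib, Finset.expect_add_distrib, ← Finset.expect_mul,
      Fintype.expect_const, c, expect_cosetMean]
    ring
  simpa only [hsum] using le_lintegral_ofReal_expect hk hkm hD

end CosetMeanKernel

variable {ι 𝓨 : Type*} [Fintype ι] [LinearOrder ι] [MeasurableSpace 𝓨] {μ : Measure 𝓨}
  {κ : Kernel (ι → ZMod 2) 𝓨} {p : (ι → ZMod 2) → 𝓨 → ℝ}

lemma integrable_prefixBhattacharyya [IsMarkovKernel κ] (hp : ∀ u, HasDensity (κ u) μ (p u))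
    (i : ι) : Integrable (fun y => prefixBhattacharyya (p · y) i) μ := by
  have hmean := hasDensity_cosetMeanKernel (H := ⊤) hp 0
  have hcm (u) := (hasDensity_cosetMeanKernel (H := vanishingOn (Set.Iic i)) hp u).measurable
  have hm : Measurable fun y => prefixBhattacharyya (p · y) i := by
    simp only [prefixBhattacharyya, Fintype.expect_eq_sum_div_card]
    fun_prop
  refine hmean.integrable.mono' hm.aestronglyMeasurable (.of_forall fun y => ?_)
  rw [Real.norm_of_nonneg (prefixBhattacharyya_nonneg i), cosetMean_top]
  exact prefixBhattacharyya_le_expect (fun u => (hp u).nonneg y) i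

lemma klDiv_compProd_cosetMeanKernel_vanishingOn_le [IsMarkovKernel κ]
    (hκ : IsTranslationCovariant κ) (hp : ∀ u, HasDensity (κ u) μ (p u))
    (P : Measure (ι → ZMod 2)) [IsProbabilityMeasure P] (S : Finset ι) :
    klDiv (P ⊗ₘ cosetMeanKernel (vanishingOn S) κ) (P ⊗ₘ cosetMeanKernel ⊤ κ) ≤
      ENNReal.ofReal (∑ i ∈ S, 2 * (1 - ∫ y, prefixBhattacharyya (p · y) i ∂μ)) := by
  have hmean := hasDensity_cosetMeanKernel (H := ⊤) hp 0
  have hZ := integrable_prefixBhattacharyya hp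
  have hterm (i) : Integrable (fun y => 2 * (cosetMean ⊤ (p · y) 0 -
      prefixBhattacharyya (p · y) i)) μ := (hmean.integrable.sub (hZ i)).const_mul 2
  calc klDiv (P ⊗ₘ cosetMeanKernel (vanishingOn S) κ) (P ⊗ₘ cosetMeanKernel ⊤ κ)
      ≤ ∫⁻ y, ENNReal.ofReal (∑ i ∈ S, 2 * (cosetMean ⊤ (p · y) 0 -
          prefixBhattacharyya (p · y) i)) ∂μ := by
        refine (klDiv_compProd_cosetMeanKernel_le_lintegral hκ hp P).trans
          (lintegral_mono fun y => ENNReal.ofReal_le_ofReal ?_)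
        rw [cosetMean_top, sub_le_iff_le_add']
        exact expect_mul_log_cosetMean_vanishingOn_le (fun u => (hp u).nonneg y) S
    _ = ENNReal.ofReal (∑ i ∈ S, 2 * (1 - ∫ y, prefixBhattacharyya (p · y) i ∂μ)) := by
        rw [← ofReal_integral_eq_lintegral_ofReal (integrable_finsetSum _ fun i _ => hterm i),
          integral_finsetSum _ fun i _ => hterm i]
        · simp only [integral_const_mul, integral_sub hmean.integrable (hZ _),
            hmean.integral_eq_one]
        · refine .of_forall fun y => Finset.sum_nonneg fun i _ => mul_nonneg zero_le_two ?_
          rw [sub_nonneg, cosetMean_top]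
          exact prefixBhattacharyya_le_expect (fun u => (hp u).nonneg y) i

end WordChannel

section Scheme

variable {𝓩 : Type*} [MeasurableSpace 𝓩] {W : Kernel (ZMod 2) 𝓩} {m : ℕ}

lemma IsBMS.isTranslationCovariant (hW : IsBMS W) : IsTranslationCovariant W := by
  obtain ⟨-, π, hπ, hinv, hWπ⟩ := hW
  have hWπ' : W 0 = (W 1).map π := by
    rw [hWπ, Measure.map_map hπ hπ, hinv.comp_self, Measure.map_id]
  intro a
  rcases eq_zero_or_eq_one a with rfl | rfl
  · exact ⟨id, measurable_id, fun u => by rw [add_zero, Measure.map_id]⟩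
  · refine ⟨π, hπ, fun u => ?_⟩
    rcases eq_zero_or_eq_one u with rfl | rfl
    · rw [zero_add, hWπ]
    · rw [CharTwo.add_self_eq_zero, hWπ']

lemma IsTranslationCovariant.combinedChannel [IsMarkovKernel W] (hW : IsTranslationCovariant W)
    (m : ℕ) : IsTranslationCovariant (combinedChannel W m) := by
  choose π hπ hWπ using hW
  intro a
  refine ⟨fun y i => π (Matrix.vecMul a (polarMatrix m) i) (y i), ?_, fun u => ?_⟩
  · exact measurable_pi_lambda _ fun i => (hπ _).comp (measurable_pi_apply i)
  · have _ (i) : IsProbabilityMeasure ((W (Matrix.vecMul u (polarMatrix m) i)).map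
        (π (Matrix.vecMul a (polarMatrix m) i))) :=
      Measure.isProbabilityMeasure_map (hπ _).aemeasurable
    change Measure.pi _ = (Measure.pi _).map _
    rw [Measure.pi_map_pi fun i => (hπ _).aemeasurable]
    simp only [Matrix.add_vecMul, Pi.add_apply, hWπ]

variable {Ω : Type*} [MeasurableSpace Ω] {P : Measure Ω} {A B C D : Set (Fin (2 ^ m))}
  {M : Ω → A → ZMod 2} {R : Ω → B → ZMod 2} {F : Ω → C → ZMod 2} {R' : Ω → D → ZMod 2}
  {U : Ω → Fin (2 ^ m) → ZMod 2} {Z : Ω → Fin (2 ^ m) → 𝓩}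

lemma IsWiretapScheme.measurable_word (h : IsWiretapScheme P W A B C D M R F R' U Z)
    (hcover : A ∪ B ∪ C ∪ D = Set.univ) : Measurable U := by
  refine measurable_pi_iff.2 fun i => ?_
  rcases hcover ▸ Set.mem_univ i with ((hi | hi) | hi) | hi
  · simpa only [← h.assign_A _ ⟨i, hi⟩] using measurable_pi_iff.1 h.measurable_M ⟨i, hi⟩
  · simpa only [← h.assign_B _ ⟨i, hi⟩] using measurable_pi_iff.1 h.measurable_R ⟨i, hi⟩
  · simpa only [← h.assign_C _ ⟨i, hi⟩] using measurable_pi_iff.1 h.measurable_F ⟨i, hi⟩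
  · simpa only [← h.assign_D _ ⟨i, hi⟩] using measurable_pi_iff.1 h.measurable_R' ⟨i, hi⟩

lemma IsWiretapScheme.map_word_singleton (h : IsWiretapScheme P W A B C D M R F R' U Z)
    (hcover : A ∪ B ∪ C ∪ D = Set.univ) (u : Fin (2 ^ m) → ZMod 2) :
    P.map U {u} = P ((fun ω => (M ω, F ω)) ⁻¹' {(A.domRestrict u, C.domRestrict u)}) *
      uniformOn Set.univ {(B.domRestrict u, D.domRestrict u)} := by
  have hword : U ⁻¹' {u} = (fun ω => (M ω, F ω)) ⁻¹' {(A.domRestrict u, C.domRestrict u)} ∩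
      (fun ω => (R ω, R' ω)) ⁻¹' {(B.domRestrict u, D.domRestrict u)} := by
    ext ω
    simp only [Set.mem_preimage, Set.mem_singleton_iff, Set.mem_inter_iff, Prod.mk.injEq,
      funext_iff, ← h.assign_A, ← h.assign_B, ← h.assign_C, ← h.assign_D]
    refine ⟨fun hu => ⟨⟨fun i => hu i, fun i => hu i⟩, fun i => hu i, fun i => hu i⟩, ?_⟩
    rintro ⟨⟨hA, hC⟩, hB, hD⟩ i
    rcases hcover ▸ Set.mem_univ i with ((hi | hi) | hi) | hi
    exacts [hA ⟨i, hi⟩, hB ⟨i, hi⟩, hC ⟨i, hi⟩, hD ⟨i, hi⟩]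
  rw [Measure.map_apply (h.measurable_word hcover) (measurableSet_singleton u), hword,
    h.random_indep.measure_inter_preimage_eq_mul _ _ (measurableSet_singleton _)
      (measurableSet_singleton _),
    ← Measure.map_apply (h.measurable_R.prodMk h.measurable_R') (measurableSet_singleton _),
    h.random_uniform.map_eq]

lemma IsWiretapScheme.measurePreserving_add (h : IsWiretapScheme P W A B C D M R F R' U Z)
    (hcover : A ∪ B ∪ C ∪ D = Set.univ) {c : Fin (2 ^ m) → ZMod 2} (hc : c ∈ vanishingOn (A ∪ C)) :
    MeasurePreserving (· + c) (P.map U) (P.map U) := by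
  classical
  refine ⟨measurable_of_finite _, Measure.ext_of_singleton fun w => ?_⟩
  obtain ⟨u, rfl⟩ : ∃ u, w = u + c := ⟨w - c, (sub_add_cancel w c).symm⟩
  have hpre : (· + c) ⁻¹' {u + c} = {u} := by
    ext v
    exact add_left_inj c
  rw [Measure.map_apply (measurable_of_finite _) (measurableSet_singleton _), hpre,
    h.map_word_singleton hcover, h.map_word_singleton hcover,
    domRestrict_add_of_mem_vanishingOn u Set.subset_union_left hc,
    domRestrict_add_of_mem_vanishingOn u Set.subset_union_right hc]
  simp only [uniformOn_univ, Measure.count_singleton]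

theorem IsWiretapScheme.mutualInfo_le [IsProbabilityMeasure P] (hW : IsBMS W)
    (h : IsWiretapScheme P W A B C D M R F R' U Z) (hcover : A ∪ B ∪ C ∪ D = Set.univ)
    {S : Finset (Fin (2 ^ m))} (hS : A ∪ C ⊆ S) :
    mutualInfo P M Z ≤
      ENNReal.ofReal (∑ i ∈ S, 2 * (1 - bhattacharyya (subchannel W m i)) / Real.log 2) := by
  have := hW.markov
  obtain ⟨μ, p, hμ, hp⟩ := exists_hasDensity (combinedChannel W m)
  have hM : M = fun ω => A.domRestrict (U ω) := by
    ext ω i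
    exact (h.assign_A ω i).symm
  have hU := h.measurable_word hcover
  have := Measure.isProbabilityMeasure_map (μ := P) hU.aemeasurable
  have hkl := klDiv_map_prodMk_le (H := vanishingOn S) (r := A.domRestrict) hU h.measurable_Z
    h.channel (fun c hc => h.measurePreserving_add hcover (vanishingOn_anti hS hc))
    (fun u _ => domRestrict_add_of_mem_vanishingOn u fun _ hi => hS (.inl hi))
  rw [mutualInfo, hM, ← Finset.sum_div, ENNReal.ofReal_div_of_pos (Real.log_pos one_lt_two)]
  gcongr
  simp only [bhattacharyya_subchannel hp]
  exact hkl.trans (klDiv_compProd_cosetMeanKernel_vanishingOn_le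
    (hW.isTranslationCovariant.combinedChannel m) hp _ S)

end Scheme

section Partition

variable {𝓨 𝓩 : Type*} [MeasurableSpace 𝓨] [MeasurableSpace 𝓩]
  (V : Kernel (ZMod 2) 𝓨) (W : Kernel (ZMod 2) 𝓩) (β : ℝ) (m : ℕ)

lemma setA_union_setC_subset_poorSet : setA V W β m ∪ setC V W β m ⊆ poorSet W β m :=
  Set.union_subset Set.inter_subset_right Set.inter_subset_right

lemma setA_union_setB_union_setC_union_setD :
    setA V W β m ∪ setB V W β m ∪ setC V W β m ∪ setD V W β m = Set.univ := by
  rw [setA, setB, setC, setD, Set.inter_union_compl, Set.union_assoc, Set.inter_union_compl,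
    Set.union_compl_self]

end Partition

section Threshold

lemma exists_forall_four_mul_two_rpow_neg_le {β β' : ℝ} (hβ' : 0 < β') (hβ : β' < β) :
    ∃ N₀ : ℕ, ∀ x : ℝ, 1 ≤ x → N₀ ≤ x → 4 * (2 : ℝ) ^ (-x ^ β) ≤ 2 ^ (-x ^ β') := by
  have hd : 0 < β - β' := sub_pos.2 hβ
  refine ⟨⌈(3 : ℝ) ^ (β - β')⁻¹⌉₊, fun x hx hN => ?_⟩
  have hthree : 3 ≤ x ^ (β - β') :=
    (Real.rpow_inv_le_iff_of_pos zero_le_three (by positivity) hd).1 ((Nat.le_ceil _).trans hN)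
  have hexp : 2 + -x ^ β ≤ -x ^ β' := by
    have hone : 1 ≤ x ^ β' := Real.one_le_rpow hx hβ'.le
    have hmul : x ^ β = x ^ β' * x ^ (β - β') := by
      rw [← Real.rpow_add (by positivity), add_sub_cancel]
    rw [hmul]
    nlinarith
  calc 4 * (2 : ℝ) ^ (-x ^ β) = 2 ^ (2 + -x ^ β) := by
        rw [Real.rpow_add zero_lt_two]
        norm_num
    _ ≤ 2 ^ (-x ^ β') := Real.rpow_le_rpow_of_exponent_le one_le_two hexp

lemma sum_poorSet_le {𝓩 : Type*} [MeasurableSpace 𝓩] (W : Kernel (ZMod 2) 𝓩) (β : ℝ) (m : ℕ)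
    [DecidablePred (· ∈ poorSet W β m)] :
    ∑ i with i ∈ poorSet W β m, 2 * (1 - bhattacharyya (subchannel W m i)) / Real.log 2 ≤
      2 ^ m * (4 * (2 : ℝ) ^ (-((2 : ℝ) ^ m) ^ β)) := by
  set δ : ℝ := 2 ^ (-((2 : ℝ) ^ m) ^ β)
  have hlog : 1 / 2 < Real.log 2 := by linarith [Real.log_two_gt_d9]
  have hterm (i) (hi : i ∈ poorSet W β m) :
      2 * (1 - bhattacharyya (subchannel W m i)) / Real.log 2 ≤ 4 * δ := by
    have hpoor : 1 - δ ≤ bhattacharyya (subchannel W m i) := hi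
    have hδ : 0 < δ := by positivity
    rw [div_le_iff₀ (by linarith)]
    nlinarith
  calc ∑ i with i ∈ poorSet W β m, 2 * (1 - bhattacharyya (subchannel W m i)) / Real.log 2
      ≤ Finset.card {i | i ∈ poorSet W β m} • (4 * δ) :=
        Finset.sum_le_card_nsmul _ _ _ fun i hi => hterm i (Finset.mem_filter_univ i |>.1 hi)
    _ ≤ 2 ^ m * (4 * δ) := by
        rw [nsmul_eq_mul]
        gcongr
        exact_mod_cast (Finset.card_le_univ _).trans_eq (Fintype.card_fin _)

end Threshold

end PolarWiretap

end

open PolarWiretap in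
theorem mainTheorem5_general (β β' : ℝ) (hβ' : 0 < β') (hβ'β : β' < β) :
    ∃ N₀ : ℕ, ∀ m : ℕ, N₀ ≤ 2 ^ m →
      ∀ (𝓩 : Type*) [MeasurableSpace 𝓩] (W : Kernel (ZMod 2) 𝓩), IsBMS W →
      ∀ (Ω : Type*) [MeasurableSpace Ω] (P : Measure Ω) [IsProbabilityMeasure P]
        (A B C D : Set (Fin (2 ^ m))), A ∪ C ⊆ poorSet W β m → A ∪ B ∪ C ∪ D = Set.univ →
      ∀ (M : Ω → A → ZMod 2) (R : Ω → B → ZMod 2) (F : Ω → C → ZMod 2) (R' : Ω → D → ZMod 2)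
        (U : Ω → Fin (2 ^ m) → ZMod 2) (Z : Ω → Fin (2 ^ m) → 𝓩),
        IsWiretapScheme P W A B C D M R F R' U Z →
        mutualInfo P M Z ≤ ENNReal.ofReal ((2 : ℝ) ^ m * (2 : ℝ) ^ (-(((2 : ℝ) ^ m) ^ β'))) := by
  classical
  obtain ⟨N₀, hN₀⟩ := exists_forall_four_mul_two_rpow_neg_le hβ' hβ'β
  refine ⟨N₀, fun m hm 𝓩 _ W hW Ω _ P _ A B C D hpoor hcover M R F R' U Z h => ?_⟩
  have hthreshold := hN₀ (2 ^ m) (one_le_pow₀ one_le_two) (mod_cast hm)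
  calc mutualInfo P M Z
      ≤ ENNReal.ofReal (∑ i with i ∈ poorSet W β m,
          2 * (1 - bhattacharyya (subchannel W m i)) / Real.log 2) :=
        h.mutualInfo_le hW hcover (by simpa using hpoor)
    _ ≤ ENNReal.ofReal (2 ^ m * (4 * 2 ^ (-((2 : ℝ) ^ m) ^ β))) :=
        ENNReal.ofReal_le_ofReal (sum_poorSet_le W β m)
    _ ≤ ENNReal.ofReal (2 ^ m * 2 ^ (-((2 : ℝ) ^ m) ^ β')) := by gcongr

theorem mainTheorem5 (β β' : ℝ) (hβ' : 0 < β') (hβ'β : β' < β) (hβ : β < 1 / 2) :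
    ∃ N₀ : ℕ, ∀ m : ℕ, 1 ≤ m → N₀ ≤ 2 ^ m →
      ∀ (𝓨 : Type*) (𝓩 : Type*) [MeasurableSpace 𝓨] [MeasurableSpace 𝓩]
        (V : ProbabilityTheory.Kernel (ZMod 2) 𝓨) (W : ProbabilityTheory.Kernel (ZMod 2) 𝓩),
        PolarWiretap.IsBMS V → PolarWiretap.IsBMS W → PolarWiretap.IsDegraded W V →
      ∀ (Ω : Type*) [MeasurableSpace Ω] (P : MeasureTheory.Measure Ω)
        [MeasureTheory.IsProbabilityMeasure P]
        (M : Ω → PolarWiretap.setA V W β m → ZMod 2)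
        (R : Ω → PolarWiretap.setB V W β m → ZMod 2)
        (F : Ω → PolarWiretap.setC V W β m → ZMod 2)
        (R' : Ω → PolarWiretap.setD V W β m → ZMod 2)
        (U : Ω → Fin (2 ^ m) → ZMod 2) (Z : Ω → Fin (2 ^ m) → 𝓩),
        PolarWiretap.IsWiretapScheme P W (PolarWiretap.setA V W β m) (PolarWiretap.setB V W β m)
          (PolarWiretap.setC V W β m) (PolarWiretap.setD V W β m) M R F R' U Z →
        PolarWiretap.mutualInfo P M Z ≤
          ENNReal.ofReal ((2 : ℝ) ^ m * (2 : ℝ) ^ (-(((2 : ℝ) ^ m) ^ β'))) := by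
  obtain ⟨N₀, hN₀⟩ := mainTheorem5_general β β' hβ' hβ'β
  exact ⟨N₀, fun m _ hm _ 𝓩 _ _ V W _ hW _ Ω _ P _ => hN₀ m hm 𝓩 W hW Ω P _ _ _ _
    (PolarWiretap.setA_union_setC_subset_poorSet V W β m)
    (PolarWiretap.setA_union_setB_union_setC_union_setD V W β m)⟩
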